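/- Let $\varphi$ be the standard normal density and $\Phi$ its distribution function, and let $\alpha\in(0,1)$. A continuous subsampling design of mass $\alpha$ is given by a measurable density $f_\xi:\mathbb R\to\mathbb R$ with $0\le f_\xi(x)\le \varphi(x)$ for all $x\in\mathbb R$ and $\int f_\xi(x)\,dx=\alpha$. For quadratic regression put $\mathbf f(x)=(1,x,x^2)^\top$ and let $\mathbf M(\xi)=\int \mathbf f(x)\mathbf f(x)^\top f_\xi(x)\,dx$ be the information matrix of $\xi$. The design $\xi^*$ is called $D$-optimal if it maximizes $\log\det\mathbf M(\xi)$ (with $\log 0=-\infty$) among all continuous subsampling designs $\xi$ of mass $\alpha$. Let $\psi(x,\xi)=\alpha\,\mathbf f(x)^\top\mathbf M(\xi)^{-1}\mathbf f(x)$ be the sensitivity function. Theorem. For every $\alpha\in(0,1)$ the following hold. (1) There are real numbers $a>b>0$ such that the design with density $$f_{\xi^*}(x)=\varphi(x)\,\mathbf 1_{(-\infty,-a]\cup[-b,b]\cup[a,\infty)}(x)$$ is a continuous subsampling design of mass $\alpha$ and is $D$-optimal, and every $D$-optimal continuous subsampling design of mass $\alpha$ has a density that equals $f_{\xi^*}$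 almost everywhere. (2) If $c=z_{1-\alpha/2}$ is the $(1-\alpha/2)$-quantile of the standard normal distribution, that is $\Phi(c)=1-\alpha/2$, and $\xi'$ has the density $\varphi(x)\,\mathbf 1_{(-\infty,-c]\cup[c,\infty)}(x)$, then $\xi'$ is a continuous subsampling design of mass $\alpha$, its information matrix is non-singular, and $\psi(0,\xi')>\psi(c,\xi')$. -/

import Mathlib

open MeasureTheory ProbabilityTheory Set
open scoped Matrix

noncomputable section

namespace Subsampling

/-- The vector of regression functions `(1, x, …, x ^ q)` of polynomial regression of degree `q`. -/
def regressor (q : ℕ) (x : ℝ) : Fin (q + 1) → ℝ := fun j => x ^ (j : ℕ)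

/-- `g` is the density of a continuous subsampling design of mass `α` for a covariate with
density `fX`: a measurable nonnegative function bounded by `fX` with integral `α`. -/
structure IsDesign (fX : ℝ → ℝ) (α : ℝ) (g : ℝ → ℝ) : Prop where
  measurable : Measurable g
  nonneg : ∀ x, 0 ≤ g x
  le_density : ∀ x, g x ≤ fX x
  integrable : Integrable g
  mass : ∫ x, g x = α

/-- The information matrix `∫ f(x) f(x)ᵀ g(x) dx` of the design with density `g`. -/
def infoMatrix (q : ℕ) (g : ℝ → ℝ) : Matrix (Fin (q + 1)) (Fin (q + 1)) ℝ :=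
  Matrix.of fun i j => ∫ x, regressor q x i * regressor q x j * g x

/-- The `D`-criterion `log (det M)` of the design with density `g`, as an extended real number,
so that a singular information matrix has the value `-∞`. -/
def dCriterion (q : ℕ) (g : ℝ → ℝ) : EReal :=
  ENNReal.log (ENNReal.ofReal (infoMatrix q g).det)

/-- `g` is the density of a `D`-optimal subsampling design of mass `α`: it maximizes the
`D`-criterion among all continuous subsampling designs of mass `α` bounded by `fX`. -/
def IsDOptimal (q : ℕ) (fX : ℝ → ℝ) (α : ℝ) (g : ℝ → ℝ) : Prop :=
  IsDesign fX α g ∧ ∀ h : ℝ → ℝ, IsDesign fX α h → dCriterion q h ≤ dCriterion q g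

/-- The sensitivity function `ψ(x) = α f(x)ᵀ M⁻¹ f(x)` of the design with density `g`
and mass `α`. -/
def sensitivity (q : ℕ) (α : ℝ) (g : ℝ → ℝ) (x : ℝ) : ℝ :=
  α * (regressor q x ⬝ᵥ ((infoMatrix q g)⁻¹ *ᵥ regressor q x))

/-- The standard normal density. -/
def stdNormalPDF : ℝ → ℝ := gaussianPDFReal 0 1

/-- The density `f_X` cut down to the three intervals `(-∞, -a]`, `[-b, b]`, `[a, ∞)`. -/
def threeIntervalDensity (fX : ℝ → ℝ) (a b : ℝ) : ℝ → ℝ :=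
  (Iic (-a) ∪ Icc (-b) b ∪ Ici a).indicator fX

/-- The density `f_X` cut down to the two tails `(-∞, -a]`, `[a, ∞)`. -/
def twoTailDensity (fX : ℝ → ℝ) (a : ℝ) : ℝ → ℝ :=
  (Iic (-a) ∪ Ici a).indicator fX

end Subsampling

end

/-! Write `s` and `q` for the second and fourth moments of a design. The determinant is at most `s
(α q - s ^ 2)`, with equality for symmetric designs (`IsDesign.det_infoMatrix_le`,
`IsDesign.det_infoMatrix_of_even`), so only `s` and `q` matter.

For a symmetric design `ψ` is a quadratic polynomial in `x ^ 2`. If `ψ(a) = ψ(b)`, then `ψ(x) -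
ψ(a)` is a positive multiple of `(x ^ 2 - a ^ 2) (x ^ 2 - b ^ 2)`, which is nonnegative exactly on
the three intervals. Taking all available mass there maximizes the integral of this quartic, and
`det_infoMatrix_add_le` turns the deficit of a competitor into a loss of determinant. This gives
optimality and, as the quartic vanishes only at four points, uniqueness.

A pair with `ψ(a) = ψ(b)` comes from the intermediate value theorem along the curve of pairs of mass
`α` (`exists_stationary`). The curve starts at the two-tail design, `b = 0`, where a Mills ratio
bound gives `ψ(0) > ψ(c)`; this sign is also part (2). -/

namespace Subsampling

open Filter Topology

/-! ### The normal density and its distribution function. -/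

lemma stdNormalPDF_apply (x : ℝ) :
    stdNormalPDF x = (√(2 * Real.pi))⁻¹ * Real.exp (-(1 / 2) * x ^ 2) := by
  simp only [stdNormalPDF, gaussianPDFReal]
  congr 2
  · simp
  · simp; ring

lemma stdNormalPDF_pos (x : ℝ) : 0 < stdNormalPDF x :=
  gaussianPDFReal_pos 0 1 x one_ne_zero

lemma stdNormalPDF_neg (x : ℝ) : stdNormalPDF (-x) = stdNormalPDF x := by
  simp [stdNormalPDF_apply]

lemma hasDerivAt_stdNormalPDF (x : ℝ) :
    HasDerivAt stdNormalPDF (-(x * stdNormalPDF x)) x := by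
  have h : HasDerivAt (fun y : ℝ => (√(2 * Real.pi))⁻¹ * Real.exp (-(1 / 2) * y ^ 2))
      ((√(2 * Real.pi))⁻¹ * (Real.exp (-(1 / 2) * x ^ 2) * (-(1 / 2) * (2 * x)))) x := by
    have := ((((hasDerivAt_id x).pow 2).const_mul (-(1 / 2) : ℝ)).exp).const_mul (√(2 * Real.pi))⁻¹
    simpa using this
  rw [funext stdNormalPDF_apply]
  convert h using 1
  ring

lemma continuous_stdNormalPDF : Continuous stdNormalPDF :=
  continuous_iff_continuousAt.2 fun x => (hasDerivAt_stdNormalPDF x).continuousAt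

lemma integrable_pow_mul_stdNormalPDF (k : ℕ) : Integrable fun x => x ^ k * stdNormalPDF x := by
  have h := (integrable_rpow_mul_exp_neg_mul_sq (b := 1 / 2) (by norm_num) (s := k)
    (by have : (0 : ℝ) ≤ k := k.cast_nonneg
        linarith)).const_mul (√(2 * Real.pi))⁻¹
  refine h.congr (ae_of_all _ fun x => ?_)
  simp only [stdNormalPDF_apply, Real.rpow_natCast]
  ring

lemma integrable_stdNormalPDF : Integrable stdNormalPDF := integrable_gaussianPDFReal 0 1

lemma integral_stdNormalPDF : ∫ x, stdNormalPDF x = 1 :=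
  integral_gaussianPDFReal_eq_one 0 one_ne_zero

lemma tendsto_pow_mul_stdNormalPDF (k : ℕ) :
    Tendsto (fun x => x ^ k * stdNormalPDF x) atTop (𝓝 0) := by
  have h := ((tendsto_rpow_abs_mul_exp_neg_mul_sq_cocompact (a := 1 / 2) (by norm_num) k).mono_left
    atTop_le_cocompact).const_mul (√(2 * Real.pi))⁻¹
  rw [mul_zero] at h
  refine h.congr' ?_
  filter_upwards [eventually_ge_atTop 0] with x hx
  simp only [stdNormalPDF_apply, Real.rpow_natCast, abs_of_nonneg hx]
  ring

/-- The centred standard normal distribution function `∫₀ˣ φ`. -/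
noncomputable def centredCDF (x : ℝ) : ℝ := ∫ t in (0 : ℝ)..x, stdNormalPDF t

lemma hasDerivAt_centredCDF (x : ℝ) : HasDerivAt centredCDF (stdNormalPDF x) x :=
  continuous_stdNormalPDF.integral_hasStrictDerivAt 0 x |>.hasDerivAt

lemma continuous_centredCDF : Continuous centredCDF :=
  continuous_iff_continuousAt.2 fun x => (hasDerivAt_centredCDF x).continuousAt

lemma strictMono_centredCDF : StrictMono centredCDF :=
  strictMono_of_hasDerivAt_pos hasDerivAt_centredCDF stdNormalPDF_pos

lemma centredCDF_zero : centredCDF 0 = 0 := by simp [centredCDF]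

lemma centredCDF_neg (x : ℝ) : centredCDF (-x) = -centredCDF x := by
  have h := intervalIntegral.integral_comp_neg (a := 0) (b := x) stdNormalPDF
  simp only [stdNormalPDF_neg, neg_zero] at h
  rw [centredCDF, centredCDF, h, intervalIntegral.integral_symm]

lemma integral_Iic_neg_eq_integral_Ioi_of_even {f : ℝ → ℝ} (hf : ∀ x, f (-x) = f x) (c : ℝ) :
    ∫ x in Iic (-c), f x = ∫ x in Ioi c, f x := by
  have h := integral_comp_neg_Iic (-c) f
  simpa only [hf, neg_neg] using h

lemma integral_Ioi_zero_stdNormalPDF : ∫ x in Ioi (0 : ℝ), stdNormalPDF x = 1 / 2 := by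
  have h := intervalIntegral.integral_Iic_add_Ioi (b := 0)
    integrable_stdNormalPDF.integrableOn integrable_stdNormalPDF.integrableOn
  have h' := integral_Iic_neg_eq_integral_Ioi_of_even stdNormalPDF_neg 0
  rw [neg_zero] at h'
  rw [h', integral_stdNormalPDF] at h
  linarith

lemma tendsto_centredCDF : Tendsto centredCDF atTop (𝓝 (1 / 2)) := by
  rw [← integral_Ioi_zero_stdNormalPDF]
  exact intervalIntegral_tendsto_integral_Ioi 0 integrable_stdNormalPDF.integrableOn tendsto_id

lemma cdf_gaussianReal_eq (x : ℝ) : cdf (gaussianReal 0 1) x = 1 / 2 + centredCDF x := by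
  rw [cdf_eq_real, measureReal_def, gaussianReal_apply_eq_integral 0 one_ne_zero,
    ENNReal.toReal_ofReal (integral_nonneg fun x => gaussianPDFReal_nonneg 0 1 x)]
  change ∫ t in Iic x, stdNormalPDF t = _
  have h := intervalIntegral.integral_Iic_sub_Iic (a := 0) (b := x)
    integrable_stdNormalPDF.integrableOn integrable_stdNormalPDF.integrableOn
  have h' := integral_Iic_neg_eq_integral_Ioi_of_even stdNormalPDF_neg 0
  rw [neg_zero, integral_Ioi_zero_stdNormalPDF] at h'
  rw [centredCDF, ← h, h']
  ring

lemma centredCDF_lt_half (x : ℝ) : centredCDF x < 1 / 2 :=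
  (strictMono_centredCDF (lt_add_one x)).trans_le
    (strictMono_centredCDF.monotone.ge_of_tendsto tendsto_centredCDF _)

lemma exists_centredCDF_eq {p : ℝ} (h₀ : 0 ≤ p) (h₁ : p < 1 / 2) : ∃ x, centredCDF x = p := by
  obtain ⟨y, hy, hy'⟩ := ((tendsto_centredCDF.eventually (lt_mem_nhds h₁)).and
    (eventually_ge_atTop 0)).exists
  obtain ⟨x, -, hx⟩ := intermediate_value_Icc hy' continuous_centredCDF.continuousOn
    ⟨centredCDF_zero.trans_le h₀, hy.le⟩
  exact ⟨x, hx⟩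

/-- The centred distribution function as an order isomorphism onto the interval of its values. -/
noncomputable def centredCDFOrderIso : ℝ ≃o Ioo (-(1 / 2) : ℝ) (1 / 2) :=
  StrictMono.orderIsoOfSurjective
    (fun x => ⟨centredCDF x, by
      have := centredCDF_lt_half (-x)
      rw [centredCDF_neg] at this
      linarith, centredCDF_lt_half x⟩)
    (fun _ _ h => strictMono_centredCDF h)
    (fun ⟨p, hp⟩ => by
      rcases le_total 0 p with h | h
      · obtain ⟨x, hx⟩ := exists_centredCDF_eq h hp.2
        exact ⟨x, Subtype.ext hx⟩
      · obtain ⟨x, hx⟩ := exists_centredCDF_eq (p := -p) (by linarith) (by linarith [hp.1])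
        exact ⟨-x, Subtype.ext (by simp [centredCDF_neg, hx])⟩)

/-- For a level `0 < k < 1 / 2` there is a continuous choice of the point whose centred
distribution function is the positive part of `centredCDF a - k`. -/
lemma exists_continuous_centredCDF_eq {k : ℝ} (hk : 0 < k) :
    ∃ b : ℝ → ℝ, Continuous b ∧ ∀ a, centredCDF (b a) = max 0 (centredCDF a - k) := by
  have hm (a : ℝ) : max 0 (centredCDF a - k) ∈ Ioo (-(1 / 2) : ℝ) (1 / 2) :=
    ⟨(by norm_num : -(1 / 2 : ℝ) < 0).trans_le (le_max_left _ _),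
      max_lt (by norm_num) (by linarith [centredCDF_lt_half a])⟩
  refine ⟨fun a => centredCDFOrderIso.symm ⟨_, hm a⟩, ?_, fun a => ?_⟩
  · exact centredCDFOrderIso.symm.continuous.comp (Continuous.subtype_mk
      (continuous_const.max (continuous_centredCDF.sub continuous_const)) _)
  · exact congrArg Subtype.val (centredCDFOrderIso.apply_symm_apply ⟨_, hm a⟩)

/-! ### Antiderivatives and truncated Gaussian integrals. -/

lemma hasDerivAt_mul_stdNormalPDF (x : ℝ) :
    HasDerivAt (fun x => -(x * stdNormalPDF x)) ((x ^ 2 - 1) * stdNormalPDF x) x := by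
  refine ((hasDerivAt_id x).mul (hasDerivAt_stdNormalPDF x)).neg.congr_deriv ?_
  simp only [id]; ring

lemma hasDerivAt_cube_add_mul_stdNormalPDF (x : ℝ) :
    HasDerivAt (fun x => -((x ^ 3 + 3 * x) * stdNormalPDF x)) ((x ^ 4 - 3) * stdNormalPDF x) x := by
  refine ((((hasDerivAt_id x).pow 3).add ((hasDerivAt_id x).const_mul 3)).mul
    (hasDerivAt_stdNormalPDF x)).neg.congr_deriv ?_
  simp; ring

/-- Mills ratio bound: the difference of the two sides is `∫ (x - c) φ(x) dx` over `x > c`. -/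
lemma mul_half_sub_centredCDF_le (c : ℝ) : c * (1 / 2 - centredCDF c) ≤ stdNormalPDF c := by
  have h := integral_Ioi_of_hasDerivAt_of_tendsto' (a := c)
    (f := fun x => -stdNormalPDF x - c * centredCDF x)
    (f' := fun x => (x - c) * stdNormalPDF x) (m := -0 - c * (1 / 2))
    (fun x _ => ((hasDerivAt_stdNormalPDF x).neg.sub
      ((hasDerivAt_centredCDF x).const_mul c)).congr_deriv (by ring))
    (((integrable_pow_mul_stdNormalPDF 1).sub (integrable_stdNormalPDF.const_mul c)).congr
      (ae_of_all _ fun x => by simp [sub_mul])).integrableOn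
    (by simpa using (tendsto_pow_mul_stdNormalPDF 0).neg.sub (tendsto_centredCDF.const_mul c))
  have h' : 0 ≤ ∫ x in Ioi c, (x - c) * stdNormalPDF x :=
    setIntegral_nonneg measurableSet_Ioi fun x hx =>
      mul_nonneg (sub_nonneg.2 (le_of_lt hx)) (stdNormalPDF_pos x).le
  rw [h] at h'
  linarith

lemma integral_three_intervals {F f : ℝ → ℝ} {a b L : ℝ} (hF : ∀ x, HasDerivAt F (f x) x)
    (hodd : ∀ x, F (-x) = -F x) (heven : ∀ x, f (-x) = f x) (hf : Integrable f)
    (hL : Tendsto F atTop (𝓝 L)) (hb : 0 ≤ b) (hab : b < a) :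
    ∫ x in Iic (-a) ∪ Icc (-b) b ∪ Ici a, f x = 2 * F b + 2 * (L - F a) := by
  rw [setIntegral_union, setIntegral_union, integral_Iic_neg_eq_integral_Ioi_of_even heven,
    integral_Ici_eq_integral_Ioi,
    integral_Ioi_of_hasDerivAt_of_tendsto' (fun x _ => hF x) hf.integrableOn hL,
    integral_Icc_eq_integral_Ioc, ← intervalIntegral.integral_of_le (by linarith),
    intervalIntegral.integral_eq_sub_of_hasDerivAt (fun x _ => hF x) hf.intervalIntegrable, hodd]
  · ring
  · exact Set.disjoint_left.2 fun x h h' => by simp only [mem_Iic, mem_Icc] at h h'; linarith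
  · exact measurableSet_Icc
  · exact hf.integrableOn
  · exact hf.integrableOn
  · refine Set.disjoint_left.2 fun x h h' => ?_
    simp only [mem_union, mem_Iic, mem_Icc, mem_Ici] at h h'
    rcases h with h | h <;> linarith
  · exact measurableSet_Ici
  · exact hf.integrableOn
  · exact hf.integrableOn


/-! ### Moments, determinant and sensitivity of a design. -/

/-- The `k`-th moment `∫ x ^ k g(x) dx` of the density `g`. -/
noncomputable def moment (g : ℝ → ℝ) (k : ℕ) : ℝ := ∫ x, x ^ k * g x

lemma infoMatrix_apply (q : ℕ) (g : ℝ → ℝ) (i j : Fin (q + 1)) :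
    infoMatrix q g i j = moment g (i + j) := by
  simp [infoMatrix, regressor, moment, pow_add]

lemma infoMatrix_two (g : ℝ → ℝ) : infoMatrix 2 g =
    !![moment g 0, moment g 1, moment g 2; moment g 1, moment g 2, moment g 3;
      moment g 2, moment g 3, moment g 4] := by
  ext i j
  rw [infoMatrix_apply]
  fin_cases i <;> fin_cases j <;> rfl

lemma det_infoMatrix_two (g : ℝ → ℝ) : (infoMatrix 2 g).det =
    moment g 2 * (moment g 0 * moment g 4 - moment g 2 ^ 2) -
      (moment g 0 * moment g 3 ^ 2 - 2 * moment g 1 * moment g 3 * moment g 2 +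
        moment g 1 ^ 2 * moment g 4) := by
  rw [infoMatrix_two, Matrix.det_fin_three]
  simp
  ring

lemma moment_congr {g h : ℝ → ℝ} (hgh : g =ᵐ[volume] h) (k : ℕ) : moment g k = moment h k :=
  integral_congr_ae (hgh.mono fun x hx => by simp only [hx])

lemma infoMatrix_congr {g h : ℝ → ℝ} (hgh : g =ᵐ[volume] h) (q : ℕ) :
    infoMatrix q g = infoMatrix q h := by
  ext i j
  rw [infoMatrix_apply, infoMatrix_apply, moment_congr hgh]

lemma moment_eq_zero_of_even {g : ℝ → ℝ} (hg : ∀ x, g (-x) = g x) {k : ℕ} (hk : Odd k) :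
    moment g k = 0 := by
  have h := integral_neg_eq_self (fun x => x ^ k * g x) (volume : Measure ℝ)
  simp only [hg, hk.neg_pow, neg_mul, integral_neg] at h
  rw [moment]
  linarith

section Design

variable {α : ℝ} {g : ℝ → ℝ}

lemma IsDesign.integrable_pow (hg : IsDesign stdNormalPDF α g) (k : ℕ) :
    Integrable fun x => x ^ k * g x := by
  refine (integrable_pow_mul_stdNormalPDF k).mono
    (((measurable_id.pow_const k).mul hg.measurable).aestronglyMeasurable)
    (ae_of_all _ fun x => ?_)
  rw [norm_mul, norm_mul, Real.norm_of_nonneg (hg.nonneg x),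
    Real.norm_of_nonneg (stdNormalPDF_pos x).le]
  exact mul_le_mul_of_nonneg_left (hg.le_density x) (norm_nonneg _)

lemma IsDesign.moment_zero (hg : IsDesign stdNormalPDF α g) : moment g 0 = α := by
  simpa [moment] using hg.mass

/-- A design of positive mass gives positive integral to a function that is positive outside a
null set. -/
lemma IsDesign.integral_mul_pos (hg : IsDesign stdNormalPDF α g) (hα : 0 < α) {w : ℝ → ℝ}
    (hw : ∀ x, 0 ≤ w x) (hw' : ∀ᵐ x, w x ≠ 0) (hi : Integrable fun x => w x * g x) :
    0 < ∫ x, w x * g x := by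
  have h0 : 0 ≤ fun x => w x * g x := fun x => mul_nonneg (hw x) (hg.nonneg x)
  refine (integral_nonneg h0).lt_of_ne fun h => hα.ne ?_
  have h1 := (integral_eq_zero_iff_of_nonneg h0 hi).1 h.symm
  rw [← hg.mass]
  refine (integral_eq_zero_of_ae ?_).symm
  filter_upwards [h1, hw'] with x hx hx'
  exact (mul_eq_zero.1 hx).resolve_left hx'

lemma IsDesign.moment_two_pos (hg : IsDesign stdNormalPDF α g) (hα : 0 < α) :
    0 < moment g 2 := by
  refine hg.integral_mul_pos hα (fun x => sq_nonneg x) ?_ (hg.integrable_pow 2)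
  filter_upwards [Measure.ae_ne volume (0 : ℝ)] with x hx
  exact pow_ne_zero 2 hx

/-- Strict Cauchy–Schwarz: `x ^ 2` has positive variance under a design, since it takes its mean `s
/ α` at no more than two points. -/
lemma IsDesign.moment_two_sq_lt (hg : IsDesign stdNormalPDF α g) (hα : 0 < α) :
    moment g 2 ^ 2 < α * moment g 4 := by
  set s := moment g 2 with hs
  have hexp : (fun x => (x ^ 2 - s / α) ^ 2 * g x) =
      fun x => x ^ 4 * g x - 2 * (s / α) * (x ^ 2 * g x) + (s / α) ^ 2 * g x := by
    funext x; ring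
  have hi4 := hg.integrable_pow 4
  have hi2 := (hg.integrable_pow 2).const_mul (2 * (s / α))
  have hi0 := hg.integrable.const_mul ((s / α) ^ 2)
  have hi42 : Integrable fun x => x ^ 4 * g x - 2 * (s / α) * (x ^ 2 * g x) := hi4.sub hi2
  have h := hg.integral_mul_pos hα (w := fun x => (x ^ 2 - s / α) ^ 2) (fun x => sq_nonneg _) ?_
    (by rw [hexp]; exact hi42.add hi0)
  · rw [hexp, integral_add hi42 hi0, integral_sub hi4 hi2, integral_const_mul,
      integral_const_mul, hg.mass] at h
    change 0 < moment g 4 - 2 * (s / α) * s + (s / α) ^ 2 * α at h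
    have := mul_pos hα h
    field_simp at this
    linarith
  · filter_upwards [Measure.ae_ne volume (√(s / α)), Measure.ae_ne volume (-√(s / α))]
      with x h₁ h₂ h₃
    have h4 : x ^ 2 = s / α := by linarith [pow_eq_zero_iff (two_ne_zero) |>.1 h₃]
    rw [← h4, Real.sqrt_sq_eq_abs] at h₁ h₂
    rcases abs_choice x with h | h <;> rw [h] at h₁ h₂ <;> simp at h₁ h₂

lemma IsDesign.moment_two_le (hg : IsDesign stdNormalPDF α g) : moment g 2 ≤ 1 := by
  have h : ∫ x, (x ^ 2 - 1) * stdNormalPDF x = 0 := by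
    have hi : Integrable fun x => (x ^ 2 - 1) * stdNormalPDF x :=
      ((integrable_pow_mul_stdNormalPDF 2).sub integrable_stdNormalPDF).congr
        (ae_of_all _ fun x => by simp [sub_mul])
    have ht : Tendsto (fun x => -(x * stdNormalPDF x)) atTop (𝓝 0) := by
      simpa using (tendsto_pow_mul_stdNormalPDF 1).neg
    have hb : Tendsto (fun x => -(x * stdNormalPDF x)) atBot (𝓝 0) := by
      have := (ht.comp tendsto_neg_atBot_atTop).neg
      simpa [Function.comp_def, stdNormalPDF_neg] using this
    rw [integral_of_hasDerivAt_of_tendsto hasDerivAt_mul_stdNormalPDF hi hb ht, sub_zero]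
  have h' : ∫ x, x ^ 2 * stdNormalPDF x = 1 := by
    simp only [sub_mul, one_mul] at h
    rw [integral_sub (integrable_pow_mul_stdNormalPDF 2) integrable_stdNormalPDF,
      integral_stdNormalPDF] at h
    linarith
  rw [← h']
  exact integral_mono (hg.integrable_pow 2) (integrable_pow_mul_stdNormalPDF 2) fun x =>
    mul_le_mul_of_nonneg_left (hg.le_density x) (sq_nonneg x)

lemma IsDesign.det_infoMatrix_le (hg : IsDesign stdNormalPDF α g) (hα : 0 < α) :
    (infoMatrix 2 g).det ≤ moment g 2 * (α * moment g 4 - moment g 2 ^ 2) := by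
  rw [det_infoMatrix_two, hg.moment_zero, sub_le_self_iff]
  refine nonneg_of_mul_nonneg_right (a := α) ?_ hα
  have h := mul_nonneg (sq_nonneg (moment g 1)) (sub_pos.2 (hg.moment_two_sq_lt hα)).le
  -- With `mₖ` the moments, `α` times the odd-moment term equals `(α m₃ - m₁ m₂) ^ 2 + m₁ ^ 2 (α m₄
  -- - m₂ ^ 2)`.
  nlinarith [sq_nonneg (α * moment g 3 - moment g 1 * moment g 2)]

lemma IsDesign.det_infoMatrix_of_even (hg : IsDesign stdNormalPDF α g)
    (he : ∀ x, g (-x) = g x) :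
    (infoMatrix 2 g).det = moment g 2 * (α * moment g 4 - moment g 2 ^ 2) := by
  rw [det_infoMatrix_two, hg.moment_zero, moment_eq_zero_of_even he (by decide : Odd 1),
    moment_eq_zero_of_even he (by decide : Odd 3)]
  ring

lemma IsDesign.det_infoMatrix_pos_of_even (hg : IsDesign stdNormalPDF α g) (hα : 0 < α)
    (he : ∀ x, g (-x) = g x) : 0 < (infoMatrix 2 g).det := by
  rw [hg.det_infoMatrix_of_even he]
  exact mul_pos (hg.moment_two_pos hα) (sub_pos.2 (hg.moment_two_sq_lt hα))

lemma IsDesign.sensitivity_of_even (hg : IsDesign stdNormalPDF α g) (hα : 0 < α)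
    (he : ∀ x, g (-x) = g x) (x : ℝ) : sensitivity 2 α g x =
      α * (moment g 4 - 2 * moment g 2 * x ^ 2 + α * x ^ 4) /
        (α * moment g 4 - moment g 2 ^ 2) + α * x ^ 2 / moment g 2 := by
  set s := moment g 2 with hs
  set q := moment g 4 with hq
  have hs0 : s ≠ 0 := (hg.moment_two_pos hα).ne'
  have hD : α * q - s ^ 2 ≠ 0 := (sub_pos.2 (hg.moment_two_sq_lt hα)).ne'
  have hu : IsUnit (infoMatrix 2 g).det := (hg.det_infoMatrix_pos_of_even hα he).ne'.isUnit
  -- Without odd moments the matrix splits into a block for `1, x ^ 2` and the entry `s` for `x`;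
  -- the vector is the resulting explicit value of `M⁻¹ f(x)`.
  have hsolve : infoMatrix 2 g *ᵥ ![(q - s * x ^ 2) / (α * q - s ^ 2), x / s,
      (α * x ^ 2 - s) / (α * q - s ^ 2)] = regressor 2 x := by
    rw [infoMatrix_two, hg.moment_zero, moment_eq_zero_of_even he (by decide : Odd 1),
      moment_eq_zero_of_even he (by decide : Odd 3), ← hs, ← hq]
    generalize hDe : α * q - s ^ 2 = D at hD
    ext i
    fin_cases i <;> simp [regressor, Matrix.mulVec, dotProduct, Fin.sum_univ_three] <;> field_simp
    · linear_combination hDe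
    · linear_combination x ^ 2 * hDe
  rw [sensitivity, ← hsolve, Matrix.mulVec_mulVec, Matrix.nonsing_inv_mul _ hu,
    Matrix.one_mulVec, hsolve]
  simp [regressor, dotProduct, Fin.sum_univ_three]
  field_simp
  ring

end Design

lemma dCriterion_le_iff {q : ℕ} {g h : ℝ → ℝ} (hg : 0 < (infoMatrix q g).det) :
    dCriterion q h ≤ dCriterion q g ↔ (infoMatrix q h).det ≤ (infoMatrix q g).det := by
  rw [dCriterion, dCriterion, ENNReal.log_le_log_iff, ENNReal.ofReal_le_ofReal_iff hg.le]


/-! ### Three-interval designs: moments, optimality and uniqueness. -/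

lemma IsDesign.of_indicator {S : Set ℝ} (hS : MeasurableSet S) :
    IsDesign stdNormalPDF (∫ x in S, stdNormalPDF x) (S.indicator stdNormalPDF) where
  measurable := continuous_stdNormalPDF.measurable.indicator hS
  nonneg := indicator_nonneg fun x _ => (stdNormalPDF_pos x).le
  le_density := indicator_le_self' fun x _ => (stdNormalPDF_pos x).le
  integrable := integrable_stdNormalPDF.indicator hS
  mass := integral_indicator hS

lemma measurableSet_three_intervals (a b : ℝ) :
    MeasurableSet (Iic (-a) ∪ Icc (-b) b ∪ Ici a) :=
  (measurableSet_Iic.union measurableSet_Icc).union measurableSet_Ici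

section ThreeInterval

variable {α a b : ℝ}

lemma isDesign_threeIntervalDensity (hb : 0 ≤ b) (hab : b < a) :
    IsDesign stdNormalPDF (1 + 2 * centredCDF b - 2 * centredCDF a)
      (threeIntervalDensity stdNormalPDF a b) := by
  have h := IsDesign.of_indicator (measurableSet_three_intervals a b)
  rwa [integral_three_intervals hasDerivAt_centredCDF centredCDF_neg stdNormalPDF_neg
    integrable_stdNormalPDF tendsto_centredCDF hb hab,
    show 2 * centredCDF b + 2 * (1 / 2 - centredCDF a) =
      1 + 2 * centredCDF b - 2 * centredCDF a by ring] at h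

lemma threeIntervalDensity_neg (x : ℝ) : threeIntervalDensity stdNormalPDF a b (-x) =
    threeIntervalDensity stdNormalPDF a b x := by
  have h : -x ∈ Iic (-a) ∪ Icc (-b) b ∪ Ici a ↔ x ∈ Iic (-a) ∪ Icc (-b) b ∪ Ici a := by
    simp only [mem_union, mem_Iic, mem_Icc, mem_Ici, neg_le_neg_iff]
    rw [le_neg (a := a), neg_le (a := x)]
    tauto
  by_cases hx : x ∈ Iic (-a) ∪ Icc (-b) b ∪ Ici a
  · rw [threeIntervalDensity, indicator_of_mem hx, indicator_of_mem (h.2 hx), stdNormalPDF_neg]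
  · rw [threeIntervalDensity, indicator_of_notMem hx, indicator_of_notMem (mt h.1 hx)]

/-- Used with `r = 1` for `k = 2` and `r = 3` for `k = 4`: subtracting the full Gaussian moment
leaves an integrand with an elementary antiderivative that vanishes at infinity. -/
lemma moment_threeIntervalDensity_sub (hg : IsDesign stdNormalPDF α
    (threeIntervalDensity stdNormalPDF a b)) (k : ℕ) (r : ℝ) :
    moment (threeIntervalDensity stdNormalPDF a b) k - r * α =
      ∫ x in Iic (-a) ∪ Icc (-b) b ∪ Ici a, (x ^ k - r) * stdNormalPDF x := by
  rw [← hg.mass, moment, ← integral_const_mul,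
    ← integral_sub (hg.integrable_pow k) (hg.integrable.const_mul r),
    ← integral_indicator (measurableSet_three_intervals a b)]
  refine integral_congr_ae (ae_of_all _ fun x => ?_)
  rw [indicator_mul_right, threeIntervalDensity]
  ring

lemma moment_two_threeIntervalDensity (hb : 0 ≤ b) (hab : b < a)
    (hg : IsDesign stdNormalPDF α (threeIntervalDensity stdNormalPDF a b)) :
    moment (threeIntervalDensity stdNormalPDF a b) 2 =
      α + 2 * (a * stdNormalPDF a) - 2 * (b * stdNormalPDF b) := by
  have h := moment_threeIntervalDensity_sub hg 2 1
  rw [integral_three_intervals (L := 0) hasDerivAt_mul_stdNormalPDF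
    (fun x => by rw [stdNormalPDF_neg]; ring) (fun x => by rw [stdNormalPDF_neg]; ring)
    (((integrable_pow_mul_stdNormalPDF 2).sub integrable_stdNormalPDF).congr
      (ae_of_all _ fun x => by simp [sub_mul]))
    (by simpa using (tendsto_pow_mul_stdNormalPDF 1).neg) hb hab] at h
  linarith

lemma moment_four_threeIntervalDensity (hb : 0 ≤ b) (hab : b < a)
    (hg : IsDesign stdNormalPDF α (threeIntervalDensity stdNormalPDF a b)) :
    moment (threeIntervalDensity stdNormalPDF a b) 4 =
      3 * α + 2 * ((a ^ 3 + 3 * a) * stdNormalPDF a) -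
        2 * ((b ^ 3 + 3 * b) * stdNormalPDF b) := by
  have h := moment_threeIntervalDensity_sub hg 4 3
  rw [integral_three_intervals (L := 0) hasDerivAt_cube_add_mul_stdNormalPDF
    (fun x => by rw [stdNormalPDF_neg]; ring) (fun x => by rw [stdNormalPDF_neg]; ring)
    (((integrable_pow_mul_stdNormalPDF 4).sub (integrable_stdNormalPDF.const_mul 3)).congr
      (ae_of_all _ fun x => by simp [sub_mul])) ?_ hb hab] at h
  · linarith
  · have := ((tendsto_pow_mul_stdNormalPDF 3).add
      ((tendsto_pow_mul_stdNormalPDF 1).const_mul 3)).neg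
    simp only [mul_zero, add_zero, neg_zero] at this
    exact this.congr fun x => by ring

/-- Bathtub principle: both factors change sign together, the quartic at the endpoints and the
difference because the design is `φ` inside and `0` outside. -/
lemma mul_threeIntervalDensity_sub_nonneg {g : ℝ → ℝ} (hg : IsDesign stdNormalPDF α g)
    (hb : 0 ≤ b) (hab : b < a) (x : ℝ) :
    0 ≤ (x ^ 2 - a ^ 2) * (x ^ 2 - b ^ 2) *
      (threeIntervalDensity stdNormalPDF a b x - g x) := by
  have ha : 0 ≤ a := hb.trans hab.le
  have hba : b ^ 2 ≤ a ^ 2 := pow_le_pow_left₀ hb hab.le 2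
  by_cases hx : x ∈ Iic (-a) ∪ Icc (-b) b ∪ Ici a
  · rw [threeIntervalDensity, indicator_of_mem hx]
    refine mul_nonneg ?_ (sub_nonneg.2 (hg.le_density x))
    have : a ^ 2 ≤ x ^ 2 ∨ x ^ 2 ≤ b ^ 2 := by
      rcases hx with (hx | hx) | hx <;> simp only [mem_Iic, mem_Icc, mem_Ici] at hx
      · exact Or.inl (by nlinarith)
      · exact Or.inr (sq_le_sq' hx.1 hx.2)
      · exact Or.inl (by nlinarith)
    rcases this with h | h
    · exact mul_nonneg (by linarith) (by linarith)
    · exact mul_nonneg_of_nonpos_of_nonpos (by linarith) (by linarith)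
  · rw [threeIntervalDensity, indicator_of_notMem hx, zero_sub]
    refine mul_nonneg_of_nonpos_of_nonpos ?_ (neg_nonpos.2 (hg.nonneg x))
    simp only [mem_union, mem_Iic, mem_Icc, mem_Ici, not_or, not_and_or, not_le] at hx
    obtain ⟨⟨h1, h2⟩, h3⟩ := hx
    refine mul_nonpos_of_nonpos_of_nonneg (by nlinarith) ?_
    rcases h2 with h | h <;> nlinarith

lemma integrable_mul_threeIntervalDensity_sub {g : ℝ → ℝ} (hg : IsDesign stdNormalPDF α g)
    (hd : IsDesign stdNormalPDF α (threeIntervalDensity stdNormalPDF a b)) :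
    Integrable (fun x => (x ^ 2 - a ^ 2) * (x ^ 2 - b ^ 2) *
      (threeIntervalDensity stdNormalPDF a b x - g x)) ∧
    ∫ x, (x ^ 2 - a ^ 2) * (x ^ 2 - b ^ 2) *
      (threeIntervalDensity stdNormalPDF a b x - g x) =
    moment (threeIntervalDensity stdNormalPDF a b) 4 - moment g 4 -
      (a ^ 2 + b ^ 2) * (moment (threeIntervalDensity stdNormalPDF a b) 2 - moment g 2) := by
  set d := threeIntervalDensity stdNormalPDF a b
  have hexp : (fun x => (x ^ 2 - a ^ 2) * (x ^ 2 - b ^ 2) * (d x - g x)) = fun x =>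
      x ^ 4 * d x - x ^ 4 * g x - (a ^ 2 + b ^ 2) * (x ^ 2 * d x - x ^ 2 * g x) +
        a ^ 2 * b ^ 2 * (d x - g x) := by
    funext x; ring
  have h4 : Integrable fun x => x ^ 4 * d x - x ^ 4 * g x :=
    (hd.integrable_pow 4).sub (hg.integrable_pow 4)
  have h2 : Integrable fun x => (a ^ 2 + b ^ 2) * (x ^ 2 * d x - x ^ 2 * g x) :=
    ((hd.integrable_pow 2).sub (hg.integrable_pow 2)).const_mul _
  have h0 : Integrable fun x => a ^ 2 * b ^ 2 * (d x - g x) :=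
    (hd.integrable.sub hg.integrable).const_mul _
  have h42 : Integrable fun x => x ^ 4 * d x - x ^ 4 * g x -
      (a ^ 2 + b ^ 2) * (x ^ 2 * d x - x ^ 2 * g x) := h4.sub h2
  rw [hexp]
  refine ⟨h42.add h0, ?_⟩
  rw [integral_add h42 h0, integral_sub h4 h2,
    integral_sub (hd.integrable_pow 4) (hg.integrable_pow 4), integral_const_mul,
    integral_sub (hd.integrable_pow 2) (hg.integrable_pow 2), integral_const_mul,
    integral_sub hd.integrable hg.integrable, hd.mass, hg.mass]
  simp only [moment]
  ring

/-- If the sensitivity of the three-interval design takes equal values at `a` and `b`, then the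
determinant of every competing design falls short by at least a multiple of its distance. -/
lemma det_infoMatrix_add_le {g : ℝ → ℝ} (hα : 0 < α) (hg : IsDesign stdNormalPDF α g)
    (hd : IsDesign stdNormalPDF α (threeIntervalDensity stdNormalPDF a b))
    (hst : α * moment (threeIntervalDensity stdNormalPDF a b) 2 * (a ^ 2 + b ^ 2) =
      3 * moment (threeIntervalDensity stdNormalPDF a b) 2 ^ 2 -
        α * moment (threeIntervalDensity stdNormalPDF a b) 4) :
    (infoMatrix 2 g).det + α * moment g 2 * ∫ x, (x ^ 2 - a ^ 2) * (x ^ 2 - b ^ 2) *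
        (threeIntervalDensity stdNormalPDF a b x - g x) ≤
      (infoMatrix 2 (threeIntervalDensity stdNormalPDF a b)).det := by
  rw [hd.det_infoMatrix_of_even threeIntervalDensity_neg,
    (integrable_mul_threeIntervalDensity_sub hg hd).2]
  have h := hg.det_infoMatrix_le hα
  have hs := hg.moment_two_pos hα
  have hs' := hd.moment_two_pos hα
  have hD := sub_pos.2 (hd.moment_two_sq_lt hα)
  set d := threeIntervalDensity stdNormalPDF a b
  generalize moment d 2 = s' at *
  generalize moment d 4 = q' at *
  generalize moment g 2 = s at *
  generalize moment g 4 = q at *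
  refine le_of_mul_le_mul_left ?_ hs'
  have h1 := mul_le_mul_of_nonneg_left h hs'.le
  have h2 := mul_nonneg hD.le (sq_nonneg (s' - s))
  have h3 := mul_nonneg (mul_pos hs hs').le (sq_nonneg (s' - s))
  -- By `hst`, `s'` times the gap to the bound `s (α q - s ^ 2)` is `(s' - s) ^ 2 (α q' - s' ^ 2 + s
  -- s')`, which is nonnegative.
  linear_combination h1 + h2 + h3 - s * (s' - s) * hst

lemma isDOptimal_threeIntervalDensity (hα : 0 < α) (hb : 0 ≤ b) (hab : b < a)
    (hd : IsDesign stdNormalPDF α (threeIntervalDensity stdNormalPDF a b))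
    (hst : α * moment (threeIntervalDensity stdNormalPDF a b) 2 * (a ^ 2 + b ^ 2) =
      3 * moment (threeIntervalDensity stdNormalPDF a b) 2 ^ 2 -
        α * moment (threeIntervalDensity stdNormalPDF a b) 4) :
    IsDOptimal 2 stdNormalPDF α (threeIntervalDensity stdNormalPDF a b) ∧
      ∀ g, IsDOptimal 2 stdNormalPDF α g →
        g =ᵐ[volume] threeIntervalDensity stdNormalPDF a b := by
  have hpos := hd.det_infoMatrix_pos_of_even hα threeIntervalDensity_neg
  refine ⟨⟨hd, fun g hg => (dCriterion_le_iff hpos).2 ?_⟩, fun g hg => ?_⟩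
  · have h := det_infoMatrix_add_le hα hg hd hst
    have h' := mul_nonneg (mul_pos hα (hg.moment_two_pos hα)).le
      (integral_nonneg (μ := volume) (mul_threeIntervalDensity_sub_nonneg hg hb hab))
    linarith
  · have hle := hg.2 _ hd
    rw [dCriterion, dCriterion, ENNReal.log_le_log_iff] at hle
    -- `ENNReal.ofReal` truncates at `0`; the positive determinant rules out that case.
    have hle' := (ENNReal.ofReal_le_ofReal_iff'.1 hle).resolve_right hpos.not_ge
    have h := det_infoMatrix_add_le hα hg.1 hd hst
    have hs := mul_pos hα (hg.1.moment_two_pos hα)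
    have hnn := mul_threeIntervalDensity_sub_nonneg hg.1 hb hab
    have h0 := le_antisymm (nonpos_of_mul_nonpos_right (by linarith) hs) (integral_nonneg hnn)
    have hae := (integral_eq_zero_iff_of_nonneg hnn
      (integrable_mul_threeIntervalDensity_sub hg.1 hd).1).1 h0
    filter_upwards [hae, Measure.ae_ne volume a, Measure.ae_ne volume (-a),
      Measure.ae_ne volume b, Measure.ae_ne volume (-b)] with x hx h1 h2 h3 h4
    have h5 : x ^ 2 - a ^ 2 ≠ 0 := sub_ne_zero.2 fun h => (sq_eq_sq_iff_eq_or_eq_neg.1 h).elim h1 h2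
    have h6 : x ^ 2 - b ^ 2 ≠ 0 := sub_ne_zero.2 fun h => (sq_eq_sq_iff_eq_or_eq_neg.1 h).elim h3 h4
    exact (sub_eq_zero.1 ((mul_eq_zero.1 hx).resolve_left (mul_ne_zero h5 h6))).symm

end ThreeInterval

/-! ### The two-tail design, treated as the degenerate case `b = 0`, and existence of a stationary
pair. -/

lemma threeIntervalDensity_zero_ae_eq (c : ℝ) :
    threeIntervalDensity stdNormalPDF c 0 =ᵐ[volume] twoTailDensity stdNormalPDF c := by
  filter_upwards [Measure.ae_ne volume (0 : ℝ)] with x hx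
  have : x ∈ Iic (-c) ∪ Icc (-0) 0 ∪ Ici c ↔ x ∈ Iic (-c) ∪ Ici c := by
    simp [hx]
  by_cases h : x ∈ Iic (-c) ∪ Ici c
  · rw [threeIntervalDensity, twoTailDensity, indicator_of_mem h, indicator_of_mem (this.2 h)]
  · rw [threeIntervalDensity, twoTailDensity, indicator_of_notMem h,
      indicator_of_notMem (mt this.1 h)]

lemma isDesign_twoTailDensity {c : ℝ} (hc : 0 < c) :
    IsDesign stdNormalPDF (1 - 2 * centredCDF c) (twoTailDensity stdNormalPDF c) := by
  have h := IsDesign.of_indicator (measurableSet_Iic.union measurableSet_Ici :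
    MeasurableSet (Iic (-c) ∪ Ici c))
  have h' := (isDesign_threeIntervalDensity le_rfl hc).mass
  rw [integral_congr_ae (threeIntervalDensity_zero_ae_eq c)] at h'
  have h'' : ∫ x in Iic (-c) ∪ Ici c, stdNormalPDF x = 1 - 2 * centredCDF c := by
    rw [← h.mass]
    change ∫ x, twoTailDensity stdNormalPDF c x = _
    rw [h', centredCDF_zero]; ring
  rwa [h''] at h

/-- The two-tail design is improved by adding mass at the origin. -/
lemma moment_twoTail_lt {α c : ℝ} (hc : 0 < c) (hα : 0 < α)
    (hg : IsDesign stdNormalPDF α (threeIntervalDensity stdNormalPDF c 0))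
    (hmass : α = 1 - 2 * centredCDF c) :
    α * moment (threeIntervalDensity stdNormalPDF c 0) 2 * c ^ 2 <
      3 * moment (threeIntervalDensity stdNormalPDF c 0) 2 ^ 2 -
        α * moment (threeIntervalDensity stdNormalPDF c 0) 4 := by
  rw [moment_two_threeIntervalDensity le_rfl hc hg, moment_four_threeIntervalDensity le_rfl hc hg]
  have hmills := mul_half_sub_centredCDF_le c
  have hp := stdNormalPDF_pos c
  generalize stdNormalPDF c = p at *
  -- The claim reduces to `6 α c p + 12 c² p² > 4 α c³ p + α² c²`; this bound gives `4 α c³ p ≤ 8 c²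
  -- p²` and `α² c² ≤ 2 α c p`.
  have hm : c * α ≤ 2 * p := by rw [hmass]; linarith
  have h1 := mul_le_mul_of_nonneg_left hm (mul_pos (pow_pos hc 2) hp).le
  have h2 := mul_le_mul_of_nonneg_left hm (mul_pos hc hα).le
  have h3 := mul_pos (mul_pos hc hα) hp
  have h4 := mul_pos (pow_pos hc 2) (pow_pos hp 2)
  nlinarith

/-- The moment equation says `ψ(a) = ψ(b)`. For each `a ≥ c` the mass constraint fixes `b`, and the
defect `H` of the equation changes sign along this curve. -/
lemma exists_stationary {α : ℝ} (hα : α ∈ Ioo (0 : ℝ) 1) : ∃ a b : ℝ, 0 < b ∧ b < a ∧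
    IsDesign stdNormalPDF α (threeIntervalDensity stdNormalPDF a b) ∧
    α * moment (threeIntervalDensity stdNormalPDF a b) 2 * (a ^ 2 + b ^ 2) =
      3 * moment (threeIntervalDensity stdNormalPDF a b) 2 ^ 2 -
        α * moment (threeIntervalDensity stdNormalPDF a b) 4 := by
  obtain ⟨hα0, hα1⟩ := hα
  have hk : 0 < (1 - α) / 2 := by linarith
  obtain ⟨c, hc⟩ := exists_centredCDF_eq hk.le (by linarith)
  have hc0 : 0 < c := strictMono_centredCDF.lt_iff_lt.1 (by rw [centredCDF_zero, hc]; exact hk)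
  obtain ⟨b, hbc, hb⟩ := exists_continuous_centredCDF_eq hk
  have hb' {a : ℝ} (ha : c ≤ a) : centredCDF (b a) = centredCDF a - (1 - α) / 2 := by
    rw [hb, max_eq_right]
    have := strictMono_centredCDF.monotone ha
    linarith
  have hb0 (a : ℝ) : 0 ≤ b a := strictMono_centredCDF.le_iff_le.1 (by
    rw [centredCDF_zero, hb]; exact le_max_left _ _)
  have hba {a : ℝ} (ha : c ≤ a) : b a < a := strictMono_centredCDF.lt_iff_lt.1 (by
    rw [hb' ha]; linarith)
  have hd {a : ℝ} (ha : c ≤ a) :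
      IsDesign stdNormalPDF α (threeIntervalDensity stdNormalPDF a (b a)) := by
    have := isDesign_threeIntervalDensity (hb0 a) (hba ha)
    rwa [hb' ha, show 1 + 2 * (centredCDF a - (1 - α) / 2) - 2 * centredCDF a = α by ring] at this
  have hbc0 : b c = 0 := strictMono_centredCDF.injective (by
    rw [hb' le_rfl, hc, centredCDF_zero, sub_self])
  let s (a : ℝ) := α + 2 * (a * stdNormalPDF a) - 2 * (b a * stdNormalPDF (b a))
  let q (a : ℝ) := 3 * α + 2 * ((a ^ 3 + 3 * a) * stdNormalPDF a) -
    2 * ((b a ^ 3 + 3 * b a) * stdNormalPDF (b a))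
  let H (a : ℝ) := α * s a * (a ^ 2 + b a ^ 2) - (3 * s a ^ 2 - α * q a)
  have hs {a : ℝ} (ha : c ≤ a) : moment (threeIntervalDensity stdNormalPDF a (b a)) 2 = s a :=
    moment_two_threeIntervalDensity (hb0 a) (hba ha) (hd ha)
  have hq {a : ℝ} (ha : c ≤ a) : moment (threeIntervalDensity stdNormalPDF a (b a)) 4 = q a :=
    moment_four_threeIntervalDensity (hb0 a) (hba ha) (hd ha)
  have hφ := continuous_stdNormalPDF
  have hH : Continuous H := by fun_prop
  have hHc : H c < 0 := by
    have h := moment_twoTail_lt hc0 hα0 (hbc0 ▸ hd le_rfl) (by rw [hc]; ring)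
    have h2 := hs le_rfl
    have h4 := hq le_rfl
    rw [hbc0] at h2 h4
    rw [h2, h4] at h
    simp only [H, hbc0]
    linarith
  -- Since `0 < s ≤ 1`, such a point has `α s a₁ ^ 2 ≥ 3 s ≥ 3 s ^ 2`, which makes `H` nonnegative.
  obtain ⟨a₁, ha₁, ha₁'⟩ : ∃ a₁, c ≤ a₁ ∧ 3 ≤ α * a₁ ^ 2 := by
    refine ⟨max c (3 / α), le_max_left _ _, ?_⟩
    have h3 : 3 / α ≤ max c (3 / α) := le_max_right _ _
    have h4 : 3 ≤ 3 / α := by rw [le_div_iff₀ hα0]; linarith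
    rw [div_le_iff₀ hα0] at h3
    nlinarith
  have hH1 : 0 ≤ H a₁ := by
    have h1 := (hd ha₁).moment_two_le
    have h2 := (hd ha₁).moment_two_pos hα0
    have h3 := (hd ha₁).moment_two_sq_lt hα0
    rw [hs ha₁] at h1 h2 h3
    rw [hq ha₁] at h3
    have h4 := mul_le_mul_of_nonneg_left ha₁' h2.le
    have h5 := mul_nonneg (mul_pos hα0 h2).le (sq_nonneg (b a₁))
    have h6 := mul_le_mul_of_nonneg_left h1 h2.le
    simp only [H]
    nlinarith [sq_nonneg (s a₁)]
  obtain ⟨a, ⟨ha, -⟩, hHa⟩ := intermediate_value_Icc ha₁ hH.continuousOn ⟨hHc.le, hH1⟩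
  -- Strictness here is what makes `b a` positive.
  have hca : c < a := ha.lt_of_ne fun h => by rw [← h] at hHa; exact hHc.ne hHa
  refine ⟨a, b a, strictMono_centredCDF.lt_iff_lt.1 ?_, hba ha, hd ha, ?_⟩
  · rw [hb' ha, centredCDF_zero, ← hc]
    linarith [strictMono_centredCDF hca]
  · rw [hs ha, hq ha]
    exact sub_eq_zero.1 hHa

lemma sensitivity_twoTailDensity_lt {α c : ℝ} (hc : 0 < c) (hα : 0 < α)
    (hmass : α = 1 - 2 * centredCDF c) :
    sensitivity 2 α (twoTailDensity stdNormalPDF c) c <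
      sensitivity 2 α (twoTailDensity stdNormalPDF c) 0 := by
  have hd : IsDesign stdNormalPDF α (threeIntervalDensity stdNormalPDF c 0) := by
    have := isDesign_threeIntervalDensity le_rfl hc
    rwa [centredCDF_zero, mul_zero, add_zero, ← hmass] at this
  have h := moment_twoTail_lt hc hα hd hmass
  have hs := hd.moment_two_pos hα
  have hD := sub_pos.2 (hd.moment_two_sq_lt hα)
  simp only [sensitivity, ← infoMatrix_congr (threeIntervalDensity_zero_ae_eq c)]
  change sensitivity 2 α (threeIntervalDensity stdNormalPDF c 0) c <
    sensitivity 2 α (threeIntervalDensity stdNormalPDF c 0) 0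
  rw [hd.sensitivity_of_even hα threeIntervalDensity_neg,
    hd.sensitivity_of_even hα threeIntervalDensity_neg]
  generalize moment (threeIntervalDensity stdNormalPDF c 0) 2 = s at *
  generalize moment (threeIntervalDensity stdNormalPDF c 0) 4 = q at *
  rw [div_add_div _ _ hD.ne' hs.ne', div_add_div _ _ hD.ne' hs.ne']
  refine div_lt_div_of_pos_right ?_ (mul_pos hD hs)
  -- `ψ(c) - ψ(0)` is `α c ^ 2 (α s c ^ 2 + α q - 3 s ^ 2)` over the positive `s (α q - s ^ 2)`.
  have := mul_lt_mul_of_pos_left h (mul_pos hα (pow_pos hc 2))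
  linear_combination this

lemma det_infoMatrix_twoTailDensity_pos {α c : ℝ} (hc : 0 < c) (hα : 0 < α)
    (hmass : α = 1 - 2 * centredCDF c) :
    0 < (infoMatrix 2 (twoTailDensity stdNormalPDF c)).det := by
  have := isDesign_threeIntervalDensity le_rfl hc
  rw [centredCDF_zero, mul_zero, add_zero, ← hmass] at this
  rw [← infoMatrix_congr (threeIntervalDensity_zero_ae_eq c)]
  exact this.det_infoMatrix_pos_of_even hα threeIntervalDensity_neg

end Subsampling

theorem mainTheorem4 (α : ℝ) (hα : α ∈ Set.Ioo (0 : ℝ) 1) :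
    (∃ a b : ℝ, 0 < b ∧ b < a ∧
      Subsampling.IsDOptimal 2 Subsampling.stdNormalPDF α
        (Subsampling.threeIntervalDensity Subsampling.stdNormalPDF a b) ∧
      ∀ g : ℝ → ℝ, Subsampling.IsDOptimal 2 Subsampling.stdNormalPDF α g →
        g =ᵐ[volume] Subsampling.threeIntervalDensity Subsampling.stdNormalPDF a b) ∧
    (∀ c : ℝ, cdf (gaussianReal 0 1) c = 1 - α / 2 →
      Subsampling.IsDesign Subsampling.stdNormalPDF α
        (Subsampling.twoTailDensity Subsampling.stdNormalPDF c) ∧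
      (Subsampling.infoMatrix 2
        (Subsampling.twoTailDensity Subsampling.stdNormalPDF c)).det ≠ 0 ∧
      Subsampling.sensitivity 2 α
          (Subsampling.twoTailDensity Subsampling.stdNormalPDF c) c <
        Subsampling.sensitivity 2 α
          (Subsampling.twoTailDensity Subsampling.stdNormalPDF c) 0) := by
  refine ⟨?_, fun c hc => ?_⟩
  · obtain ⟨a, b, hb, hab, hd, hst⟩ := Subsampling.exists_stationary hα
    exact ⟨a, b, hb, hab, Subsampling.isDOptimal_threeIntervalDensity hα.1 hb.le hab hd hst⟩
  · rw [Subsampling.cdf_gaussianReal_eq] at hc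
    have hc0 : 0 < c := Subsampling.strictMono_centredCDF.lt_iff_lt.1 (by
      rw [Subsampling.centredCDF_zero]; linarith [hα.2])
    have hmass : α = 1 - 2 * Subsampling.centredCDF c := by linarith
    have hd := Subsampling.isDesign_twoTailDensity hc0
    rw [← hmass] at hd
    exact ⟨hd, (Subsampling.det_infoMatrix_twoTailDensity_pos hc0 hα.1 hmass).ne',
      Subsampling.sensitivity_twoTailDensity_lt hc0 hα.1 hmass⟩
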